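/- Let $d$ be the dimension, let $1<p,q,r<\infty$ satisfy $\frac1p+\frac1q+\frac1r=2$, and let $r'=r/(r-1)$ be the exponent conjugate to $r$. Let $L_s=L_s(\mathbb{R}^d)$ denote the Lebesgue space of complex-valued functions with its norm $\|\cdot\|_s$, and let $k\in L_q$ be arbitrary (no symmetry, positivity or monotonicity is assumed). Then the convolution operator $$K:f\mapsto k*f,\qquad (k*f)(x)=\int_{\mathbb{R}^d}k(x-y)f(y)\,dy,$$ is a well-defined bounded operator from $L_p$ to $L_{r'}$ (for every $f\in L_p$ the integral converges absolutely for almost every $x$, and $k*f\in L_{r'}$), and it has a maximizer: writing $$\|K\|_{p,r}=\sup\{\|k*f\|_{r'} : f\in L_p,\ \|f\|_p\le 1\}<\infty$$ for its operator norm, there exists $f\in L_p$ with $\|f\|_p=1$ and $\|k*f\|_{r'}=\|K\|_{p,r}$. -/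

import Mathlib

open MeasureTheory
open scoped ENNReal

/-- The convolution operator with kernel `k` on complex-valued functions on `ℝ^d`:
`f ↦ k * f`. -/
noncomputable def convOp {d : ℕ} (k f : EuclideanSpace ℝ (Fin d) → ℂ) :
    EuclideanSpace ℝ (Fin d) → ℂ :=
  convolution k f (ContinuousLinearMap.mul ℂ ℂ) volume

/-- The operator in the usual form `(k * f)(x) = ∫ k(x - y) f(y) dy`. -/
theorem convOp_apply {d : ℕ} (k f : EuclideanSpace ℝ (Fin d) → ℂ)
    (x : EuclideanSpace ℝ (Fin d)) : convOp k f x = ∫ y, k (x - y) * f y := by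
  simp [convOp, convolution_eq_swap]

/-- The norm of `f ↦ k * f` as an operator from `L_p(ℝ^d)` to `L_s(ℝ^d)`, as an extended
nonnegative real: the supremum of `‖k * f‖_s` over the unit ball of `L_p`. -/
noncomputable def convOpNorm {d : ℕ} (k : EuclideanSpace ℝ (Fin d) → ℂ) (p s : ℝ≥0∞) : ℝ≥0∞ :=
  ⨆ (f : EuclideanSpace ℝ (Fin d) → ℂ) (_ : MemLp f p volume) (_ : eLpNorm f p volume ≤ 1),
    eLpNorm (convOp k f) s volume

/-- `f ↦ k * f` is a well-defined bounded operator from `L_p(ℝ^d)` to `L_s(ℝ^d)`: for `f ∈ L_p`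
the convolution integral converges absolutely at almost every point and defines an element of
`L_s`, and the operator norm is finite. -/
structure IsBoundedConvOp {d : ℕ} (k : EuclideanSpace ℝ (Fin d) → ℂ) (p s : ℝ≥0∞) : Prop where
  exists_ae : ∀ f : EuclideanSpace ℝ (Fin d) → ℂ, MemLp f p volume →
    ∀ᵐ x, Integrable (fun y => k (x - y) * f y) volume
  memLp : ∀ f : EuclideanSpace ℝ (Fin d) → ℂ, MemLp f p volume → MemLp (convOp k f) s volume
  norm_lt_top : convOpNorm k p s < ⊤

/-- `f` is a maximizer of `f ↦ k * f` as an operator from `L_p(ℝ^d)` to `L_s(ℝ^d)`. -/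
structure IsConvMaximizer {d : ℕ} (k : EuclideanSpace ℝ (Fin d) → ℂ) (p s : ℝ≥0∞)
    (f : EuclideanSpace ℝ (Fin d) → ℂ) : Prop where
  memLp : MemLp f p volume
  norm_eq_one : eLpNorm f p volume = 1
  norm_conv_eq : eLpNorm (convOp k f) s volume = convOpNorm k p s

/-!
Write `s = r'`, so that `1/p + 1/q = 1 + 1/s` and `p, q < s`. Young's inequality makes convolution
by `k` a bounded operator `T : L_p → L_s` (`convLp`). To see that its norm is attained, it suffices
to find `u n` in the unit ball of `L_p` with `‖T (u n)‖ → ‖T‖` such that `T (u n)` converges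
along some filter: `L_p` is uniformly convex (`uniformConvexSpace_Lp`), and therefore `u n`
converges as well (`ContinuousLinearMap.exists_norm_apply_eq_opNorm`). No weak compactness is
needed.

The convergence of `T (u n)` is a matter of concentration and compactness.

* The maximizing sequence does not vanish. If `k` lives in a ball of radius `ρ`, the convolution at
  `x` sees only the part of `f` in the ball of radius `ρ` about `x`, and Young's inequality improves
  to `‖T f‖^s ≤ ‖k‖^s ‖f‖^p sup_x ‖f 1_{B(x, ρ)}‖^(s - p)` (`norm_convLp_rpow_le`). A near-maximizer
  thus has a fixed amount of mass in some ball of fixed radius, which is translated to the origin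
  (`exists_le_norm_trunc_closedBall`, `exists_translate`).
* It does not split. A near-maximizer has little mass on one of many disjoint annuli about the
  origin; up to small errors `T` maps the parts inside and outside of it to functions with disjoint
  supports, so their norms add up like `(a^s + b^s)^(1/s)`, where `a^p + b^p ≤ 1`. As `p < s`, this
  is close to `1` only if `a` or `b` is (`exists_norm_trunc_compl_closedBall_le`). Hence the
  sequence is tight.
* On a fixed ball, a continuous compactly supported kernel gives equicontinuous images, which
  converge along any ultrafilter (`exists_tendsto_convLp_trunc`). Such kernels are dense in `L_q`,
  and so `T (u n)` is Cauchy along an ultrafilter (`exists_norm_convLp_eq`).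
-/

open Metric Filter Topology

/-! ### Young's inequality -/

/-- Exponents `1 < p, q` and `0 < s` related by `1/p + 1/q = 1 + 1/s`, those for which
Young's inequality `L_q * L_p ⊆ L_s` holds and both `p` and `q` are less than `s`. -/
structure YoungExponents (p q s : ℝ) : Prop where
  one_lt_left : 1 < p
  one_lt_right : 1 < q
  pos : 0 < s
  inv_add_inv : p⁻¹ + q⁻¹ = 1 + s⁻¹

namespace YoungExponents

variable {p q s : ℝ}

theorem left_pos (h : YoungExponents p q s) : 0 < p := zero_lt_one.trans h.one_lt_left

theorem right_pos (h : YoungExponents p q s) : 0 < q := zero_lt_one.trans h.one_lt_right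

theorem left_lt (h : YoungExponents p q s) : p < s := by
  have h1 := inv_lt_one_of_one_lt₀ h.one_lt_right
  have h2 := h.inv_add_inv
  exact (inv_lt_inv₀ h.pos h.left_pos).1 (by linarith)

theorem right_lt (h : YoungExponents p q s) : q < s := by
  have h1 := inv_lt_one_of_one_lt₀ h.one_lt_left
  have h2 := h.inv_add_inv
  exact (inv_lt_inv₀ h.pos h.right_pos).1 (by linarith)

theorem one_lt (h : YoungExponents p q s) : 1 < s := h.one_lt_left.trans h.left_lt

end YoungExponents

theorem eLpNorm_ofReal_rpow {α F : Type*} [MeasurableSpace α] {μ : Measure α}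
    [NormedAddCommGroup F] {p : ℝ} (hp : 0 < p) (f : α → F) :
    eLpNorm f (ENNReal.ofReal p) μ ^ p = ∫⁻ x, ‖f x‖ₑ ^ p ∂μ := by
  rw [eLpNorm_eq_lintegral_rpow_enorm_toReal (by simpa using hp) ENNReal.ofReal_ne_top,
    ENNReal.toReal_ofReal hp.le, ← ENNReal.rpow_mul, one_div, inv_mul_cancel₀ hp.ne',
    ENNReal.rpow_one]

/-- Hölder's inequality for `u v = (u^q v^p)^(1/s) · (u^q)^(1/q - 1/s) · (v^p)^(1/p - 1/s)`. -/
theorem YoungExponents.lintegral_mul_rpow_le {p q s : ℝ} (h : YoungExponents p q s)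
    {α : Type*} [MeasurableSpace α] {μ : Measure α} {u v : α → ℝ≥0∞} (hu : AEMeasurable u μ)
    (hv : AEMeasurable v μ) :
    (∫⁻ y, u y * v y ∂μ) ^ s ≤
      (∫⁻ y, u y ^ q * v y ^ p ∂μ) * (∫⁻ y, u y ^ q ∂μ) ^ (s / q - 1)
        * (∫⁻ y, v y ^ p ∂μ) ^ (s / p - 1) := by
  have hp := h.left_pos
  have hq := h.right_pos
  have hs := h.pos
  have hps : 0 ≤ p⁻¹ - s⁻¹ := sub_nonneg.2 ((inv_le_inv₀ hs hp).2 h.left_lt.le)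
  have hqs : 0 ≤ q⁻¹ - s⁻¹ := sub_nonneg.2 ((inv_le_inv₀ hs hq).2 h.right_lt.le)
  have key := ENNReal.lintegral_prod_norm_pow_le (μ := μ) (Finset.univ : Finset (Fin 3))
    (f := ![fun y => u y ^ q * v y ^ p, fun y => u y ^ q, fun y => v y ^ p])
    (p := ![s⁻¹, q⁻¹ - s⁻¹, p⁻¹ - s⁻¹])
    (by
      intro i _
      fin_cases i
      · exact (hu.pow_const q).mul (hv.pow_const p)
      · exact hu.pow_const q
      · exact hv.pow_const p)
    (by
      have := h.inv_add_inv
      simp only [Fin.sum_univ_three, Matrix.cons_val_zero, Matrix.cons_val_one, Matrix.cons_val]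
      linarith)
    (by
      intro i _
      fin_cases i
      · exact (inv_pos.2 hs).le
      · exact hqs
      · exact hps)
  simp only [Fin.prod_univ_three, Matrix.cons_val_zero, Matrix.cons_val_one,
    Matrix.cons_val] at key
  have hint : ∀ y, (u y ^ q * v y ^ p) ^ s⁻¹ * (u y ^ q) ^ (q⁻¹ - s⁻¹) * (v y ^ p) ^ (p⁻¹ - s⁻¹)
      = u y * v y := by
    intro y
    rw [ENNReal.mul_rpow_of_nonneg _ _ (inv_pos.2 hs).le, mul_right_comm (_ ^ s⁻¹), mul_assoc,
      ← ENNReal.rpow_add_of_nonneg _ _ (inv_pos.2 hs).le hqs,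
      ← ENNReal.rpow_add_of_nonneg _ _ (inv_pos.2 hs).le hps, add_sub_cancel, add_sub_cancel,
      ENNReal.rpow_rpow_inv hq.ne', ENNReal.rpow_rpow_inv hp.ne']
  simp_rw [hint] at key
  refine (ENNReal.rpow_le_rpow key hs.le).trans_eq ?_
  rw [ENNReal.mul_rpow_of_nonneg _ _ hs.le, ENNReal.mul_rpow_of_nonneg _ _ hs.le,
    ENNReal.rpow_inv_rpow hs.ne', ← ENNReal.rpow_mul, ← ENNReal.rpow_mul, sub_mul, sub_mul,
    inv_mul_cancel₀ hs.ne', inv_mul_eq_div, inv_mul_eq_div]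

section Convolution

variable {d : ℕ} {p q s : ℝ} {k f : EuclideanSpace ℝ (Fin d) → ℂ}

theorem aestronglyMeasurable_kernel (hk : AEStronglyMeasurable k volume)
    (x : EuclideanSpace ℝ (Fin d)) : AEStronglyMeasurable (fun y => k (x - y)) volume :=
  hk.comp_quasiMeasurePreserving (quasiMeasurePreserving_sub_left_of_right_invariant volume x)

theorem aestronglyMeasurable_kernel_mul (hk : AEStronglyMeasurable k volume)
    (hf : AEStronglyMeasurable f volume) :
    AEStronglyMeasurable (fun z : EuclideanSpace ℝ (Fin d) × EuclideanSpace ℝ (Fin d) =>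
      k (z.1 - z.2) * f z.2) (volume.prod volume) := by
  have h1 : AEStronglyMeasurable (fun z : EuclideanSpace ℝ (Fin d) × EuclideanSpace ℝ (Fin d) =>
      k (z.1 - z.2)) (volume.prod volume) :=
    hk.comp_quasiMeasurePreserving (quasiMeasurePreserving_sub volume volume)
  exact h1.mul hf.comp_snd

/-- Young's inequality with control of the local size of `f`: only the part of `f` on `S x`, the
set where `k (x - ·)` lives, is seen by the convolution at `x`. For `S x = univ` this is the usual
inequality; for `S x` a ball it is the source of compactness, since `p < s`. -/
theorem YoungExponents.lintegral_conv_rpow_le (h : YoungExponents p q s)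
    (hk : AEStronglyMeasurable k volume) (hf : AEStronglyMeasurable f volume)
    {S : EuclideanSpace ℝ (Fin d) → Set (EuclideanSpace ℝ (Fin d))}
    (hS : ∀ x, MeasurableSet (S x)) (hkS : ∀ x y, y ∉ S x → k (x - y) = 0) {c : ℝ≥0∞}
    (hc : ∀ x, eLpNorm ((S x).indicator f) (ENNReal.ofReal p) volume ≤ c) :
    ∫⁻ x, (∫⁻ y, ‖k (x - y) * f y‖ₑ) ^ s ≤
      eLpNorm k (ENNReal.ofReal q) volume ^ s * eLpNorm f (ENNReal.ofReal p) volume ^ p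
        * c ^ (s - p) := by
  have hp := h.left_pos
  have hq := h.right_pos
  have hs := h.pos
  have hbound : ∀ x, (∫⁻ y, ‖k (x - y) * f y‖ₑ) ^ s ≤
      (∫⁻ y, ‖k (x - y)‖ₑ ^ q * ‖f y‖ₑ ^ p) *
        (eLpNorm k (ENNReal.ofReal q) volume ^ (s - q) * c ^ (s - p)) := by
    intro x
    have e1 : ∀ y, ‖k (x - y) * f y‖ₑ = ‖k (x - y)‖ₑ * ‖(S x).indicator f y‖ₑ := by
      intro y
      by_cases hy : y ∈ S x
      · rw [Set.indicator_of_mem hy, enorm_mul]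
      · simp [hkS x y hy]
    simp_rw [e1]
    refine (h.lintegral_mul_rpow_le (aestronglyMeasurable_kernel hk x).enorm
      (hf.indicator (hS x)).enorm).trans ?_
    rw [mul_assoc]
    gcongr ?_ * (?_ * ?_)
    · refine lintegral_mono fun y => ?_
      gcongr
      exact enorm_indicator_le_enorm_self _ _
    · rw [lintegral_sub_left_eq_self (fun y => ‖k y‖ₑ ^ q) x, ← eLpNorm_ofReal_rpow hq,
        ← ENNReal.rpow_mul]
      apply le_of_eq
      congr 1
      field_simp
    · rw [← eLpNorm_ofReal_rpow hp, ← ENNReal.rpow_mul]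
      have : p * (s / p - 1) = s - p := by field_simp
      rw [this]
      exact ENNReal.rpow_le_rpow (hc x) (sub_nonneg.2 h.left_lt.le)
  have hmeas : AEMeasurable (fun z : EuclideanSpace ℝ (Fin d) × EuclideanSpace ℝ (Fin d) =>
      ‖k (z.1 - z.2)‖ₑ ^ q * ‖f z.2‖ₑ ^ p) (volume.prod volume) :=
    ((hk.comp_quasiMeasurePreserving
      (quasiMeasurePreserving_sub volume volume)).enorm.pow_const q).mul
        (hf.comp_snd.enorm.pow_const p)
  calc ∫⁻ x, (∫⁻ y, ‖k (x - y) * f y‖ₑ) ^ s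
      ≤ ∫⁻ x, (∫⁻ y, ‖k (x - y)‖ₑ ^ q * ‖f y‖ₑ ^ p) *
        (eLpNorm k (ENNReal.ofReal q) volume ^ (s - q) * c ^ (s - p)) := lintegral_mono hbound
    _ = (∫⁻ x, ∫⁻ y, ‖k (x - y)‖ₑ ^ q * ‖f y‖ₑ ^ p) *
        (eLpNorm k (ENNReal.ofReal q) volume ^ (s - q) * c ^ (s - p)) :=
      lintegral_mul_const'' _ hmeas.lintegral_prod_right'
    _ = (eLpNorm k (ENNReal.ofReal q) volume ^ q * eLpNorm f (ENNReal.ofReal p) volume ^ p) *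
        (eLpNorm k (ENNReal.ofReal q) volume ^ (s - q) * c ^ (s - p)) := by
      rw [lintegral_lintegral_swap hmeas, eLpNorm_ofReal_rpow hp, eLpNorm_ofReal_rpow hq,
        ← lintegral_const_mul'' _ (hf.enorm.pow_const p)]
      congr 2 with y
      have hky : AEMeasurable (fun x => ‖k (x - y)‖ₑ ^ q) volume :=
        (hk.comp_measurePreserving (measurePreserving_sub_right volume y)).enorm.pow_const q
      rw [lintegral_mul_const'' _ hky, lintegral_sub_right_eq_self (fun x => ‖k x‖ₑ ^ q) y]
    _ = _ := by
      rw [mul_mul_mul_comm, ← mul_assoc, ← ENNReal.rpow_add_of_nonneg _ _ hq.le (sub_nonneg.2 h.right_lt.le),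
        add_sub_cancel]

theorem YoungExponents.lintegral_conv_rpow_le_mul (h : YoungExponents p q s)
    (hk : AEStronglyMeasurable k volume) (hf : AEStronglyMeasurable f volume) :
    ∫⁻ x, (∫⁻ y, ‖k (x - y) * f y‖ₑ) ^ s ≤
      (eLpNorm k (ENNReal.ofReal q) volume * eLpNorm f (ENNReal.ofReal p) volume) ^ s := by
  refine (h.lintegral_conv_rpow_le hk hf (S := fun _ => Set.univ) (fun _ => .univ) (by simp)
    (fun x => by rw [Set.indicator_univ])).trans_eq ?_
  rw [ENNReal.mul_rpow_of_nonneg _ _ h.pos.le, mul_assoc,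
    ← ENNReal.rpow_add_of_nonneg _ _ h.left_pos.le (sub_nonneg.2 h.left_lt.le), add_sub_cancel]

theorem eLpNorm_convOp_rpow_le (hs : 0 < s) :
    eLpNorm (convOp k f) (ENNReal.ofReal s) volume ^ s ≤
      ∫⁻ x, (∫⁻ y, ‖k (x - y) * f y‖ₑ) ^ s := by
  rw [eLpNorm_ofReal_rpow hs]
  refine lintegral_mono fun x => ?_
  rw [convOp_apply]
  exact ENNReal.rpow_le_rpow (enorm_integral_le_lintegral_enorm _) hs.le

/-- **Young's convolution inequality**. -/
theorem YoungExponents.eLpNorm_convOp_le (h : YoungExponents p q s)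
    (hk : AEStronglyMeasurable k volume) (hf : AEStronglyMeasurable f volume) :
    eLpNorm (convOp k f) (ENNReal.ofReal s) volume ≤
      eLpNorm k (ENNReal.ofReal q) volume * eLpNorm f (ENNReal.ofReal p) volume :=
  (ENNReal.rpow_le_rpow_iff h.pos).1
    ((eLpNorm_convOp_rpow_le h.pos).trans (h.lintegral_conv_rpow_le_mul hk hf))

theorem aestronglyMeasurable_convOp (hk : AEStronglyMeasurable k volume)
    (hf : AEStronglyMeasurable f volume) : AEStronglyMeasurable (convOp k f) volume := by
  have : convOp k f = fun x => ∫ y, k (x - y) * f y := funext (convOp_apply k f)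
  rw [this]
  exact (aestronglyMeasurable_kernel_mul hk hf).integral_prod_right'

theorem YoungExponents.memLp_convOp (h : YoungExponents p q s)
    (hk : MemLp k (ENNReal.ofReal q) volume) (hf : MemLp f (ENNReal.ofReal p) volume) :
    MemLp (convOp k f) (ENNReal.ofReal s) volume :=
  ⟨aestronglyMeasurable_convOp hk.1 hf.1,
    (h.eLpNorm_convOp_le hk.1 hf.1).trans_lt (ENNReal.mul_lt_top hk.2 hf.2)⟩

theorem YoungExponents.ae_integrable (h : YoungExponents p q s)
    (hk : MemLp k (ENNReal.ofReal q) volume) (hf : MemLp f (ENNReal.ofReal p) volume) :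
    ∀ᵐ x, Integrable (fun y => k (x - y) * f y) volume := by
  have hfin : ∫⁻ x, (∫⁻ y, ‖k (x - y) * f y‖ₑ) ^ s ≠ ⊤ :=
    ((h.lintegral_conv_rpow_le_mul hk.1 hf.1).trans_lt
      (ENNReal.rpow_lt_top_of_nonneg h.pos.le (ENNReal.mul_lt_top hk.2 hf.2).ne)).ne
  have hmeas : AEMeasurable (fun x => (∫⁻ y, ‖k (x - y) * f y‖ₑ) ^ s) volume :=
    (aestronglyMeasurable_kernel_mul hk.1 hf.1).enorm.lintegral_prod_right'.pow_const s
  filter_upwards [ae_lt_top' hmeas hfin] with x hx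
  exact ⟨(aestronglyMeasurable_kernel hk.1 x).mul hf.1,
    (ENNReal.rpow_lt_top_iff_of_pos h.pos).1 hx⟩

end Convolution

/-! ### Uniform convexity of `L_p` -/

section UniformConvexity

variable {F : Type*} [NormedAddCommGroup F] [NormedSpace ℝ F] [StrictConvexSpace ℝ F] {p : ℝ}

theorem norm_half_smul_add_rpow_lt (hp : 1 < p) {a b : F} (hab : a ≠ b) :
    ‖(1 / 2 : ℝ) • (a + b)‖ ^ p < (‖a‖ ^ p + ‖b‖ ^ p) / 2 := by
  have hp0 : 0 < p := zero_lt_one.trans hp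
  by_cases h : ‖a‖ = ‖b‖
  · rw [← h, add_self_div_two]
    exact Real.rpow_lt_rpow (norm_nonneg _) ((norm_midpoint_lt_iff h).2 hab) hp0
  · have h1 : ‖(1 / 2 : ℝ) • (a + b)‖ ≤ (1 / 2 : ℝ) • ‖a‖ + (1 / 2 : ℝ) • ‖b‖ := by
      rw [norm_smul, ← smul_add, smul_eq_mul, Real.norm_of_nonneg (by norm_num)]
      gcongr
      exact norm_add_le a b
    have h2 := (strictConvexOn_rpow hp).2 (norm_nonneg a) (norm_nonneg b) h
      (by norm_num : (0 : ℝ) < 1 / 2) (by norm_num : (0 : ℝ) < 1 / 2) (by norm_num)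
    refine (Real.rpow_le_rpow (norm_nonneg _) h1 hp0.le).trans_lt (h2.trans_eq ?_)
    simp only [smul_eq_mul]
    ring

theorem norm_half_smul_add_rpow_le (hp : 1 < p) (a b : F) :
    ‖(1 / 2 : ℝ) • (a + b)‖ ^ p ≤ (‖a‖ ^ p + ‖b‖ ^ p) / 2 := by
  by_cases hab : a = b
  · have : (1 / 2 : ℝ) • (b + b) = b := by rw [← two_smul ℝ, smul_smul]; norm_num
    rw [hab, this, add_self_div_two]
  · exact (norm_half_smul_add_rpow_lt hp hab).le

/-- A scalar substitute for Clarkson's inequalities, valid for all `1 < p`: up to a small multiple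
of `‖a‖ ^ p + ‖b‖ ^ p`, the distance of two vectors is controlled by the convexity gap of
`‖·‖ ^ p`. Both sides being homogeneous, it is enough to find the constant on a unit sphere, where
compactness provides it. -/
theorem exists_norm_sub_rpow_le [ProperSpace F] (hp : 1 < p) {ε : ℝ} (hε : 0 < ε) :
    ∃ C : ℝ, 0 < C ∧ ∀ a b : F, ‖a - b‖ ^ p ≤ ε * (‖a‖ ^ p + ‖b‖ ^ p)
      + C * ((‖a‖ ^ p + ‖b‖ ^ p) / 2 - ‖(1 / 2 : ℝ) • (a + b)‖ ^ p) := by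
  have hp0 : 0 < p := zero_lt_one.trans hp
  set gap : F × F → ℝ := fun z => (‖z.1‖ ^ p + ‖z.2‖ ^ p) / 2 - ‖(1 / 2 : ℝ) • (z.1 + z.2)‖ ^ p
  have hcont : Continuous gap :=
    ((((continuous_norm.comp continuous_fst).rpow_const fun _ => .inr hp0.le).add
      ((continuous_norm.comp continuous_snd).rpow_const fun _ => .inr hp0.le)).div_const 2).sub
      (((continuous_const (y := (1 / 2 : ℝ))).smul
        (continuous_fst.add continuous_snd)).norm.rpow_const fun _ => .inr hp0.le)
  have hcont' : Continuous fun z : F × F => ‖z.1 - z.2‖ ^ p :=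
    (continuous_fst.sub continuous_snd).norm.rpow_const fun _ => .inr hp0.le
  set S : Set (F × F) := sphere 0 1 ∩ {z | ε ≤ ‖z.1 - z.2‖ ^ p}
  have hS : IsCompact S := (isCompact_sphere 0 1).inter_right (isClosed_le continuous_const hcont')
  obtain ⟨δ, hδ, hδS⟩ : ∃ δ : ℝ, 0 < δ ∧ ∀ z ∈ S, δ ≤ gap z := by
    refine hS.exists_forall_le' (a := 0) hcont.continuousOn fun z hz => ?_
    have hne : z.1 ≠ z.2 := by
      intro h
      have := hz.2
      rw [Set.mem_ofPred_eq, h, sub_self, norm_zero, Real.zero_rpow hp0.ne'] at this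
      exact this.not_gt hε
    exact sub_pos.2 (norm_half_smul_add_rpow_lt hp hne)
  have hgap0 : ∀ z, 0 ≤ gap z := fun z => sub_nonneg.2 (norm_half_smul_add_rpow_le hp z.1 z.2)
  have hsphere : ∀ z ∈ sphere (0 : F × F) 1, ‖z.1 - z.2‖ ^ p ≤
      ε * (‖z.1‖ ^ p + ‖z.2‖ ^ p) + 2 ^ p / δ * gap z := by
    intro z hz
    rw [mem_sphere_zero_iff_norm, Prod.norm_def] at hz
    have h1 : ‖z.1‖ ≤ 1 := hz ▸ le_max_left _ _
    have h2 : ‖z.2‖ ≤ 1 := hz ▸ le_max_right _ _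
    have n1 : 0 ≤ ‖z.1‖ ^ p := by positivity
    have n2 : 0 ≤ ‖z.2‖ ^ p := by positivity
    by_cases h : ε ≤ ‖z.1 - z.2‖ ^ p
    · have h3 : δ ≤ gap z :=
        hδS z ⟨by rw [mem_sphere_zero_iff_norm, Prod.norm_def, hz], h⟩
      have h4 : ‖z.1 - z.2‖ ^ p ≤ 2 ^ p :=
        Real.rpow_le_rpow (norm_nonneg _) ((norm_sub_le _ _).trans (by linarith)) hp0.le
      have h5 : (2 : ℝ) ^ p ≤ 2 ^ p / δ * gap z := by
        rw [div_mul_eq_mul_div, le_div_iff₀ hδ]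
        gcongr
      have : 0 ≤ ε * (‖z.1‖ ^ p + ‖z.2‖ ^ p) := by positivity
      linarith
    · have h6 : 1 ≤ ‖z.1‖ ^ p + ‖z.2‖ ^ p := by
        rcases max_choice ‖z.1‖ ‖z.2‖ with h' | h' <;> rw [h'] at hz <;> rw [hz, Real.one_rpow]
          <;> linarith
      have h7 : 0 ≤ 2 ^ p / δ * gap z := mul_nonneg (by positivity) (hgap0 z)
      have h8 : ε * 1 ≤ ε * (‖z.1‖ ^ p + ‖z.2‖ ^ p) := by gcongr
      linarith [not_le.1 h]
  refine ⟨2 ^ p / δ, by positivity, fun a b => ?_⟩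
  by_cases h0 : ((a, b) : F × F) = 0
  · obtain ⟨rfl, rfl⟩ := Prod.mk_eq_zero.1 h0
    simp [Real.zero_rpow hp0.ne']
  set t := ‖((a, b) : F × F)‖
  have ht : 0 < t := norm_pos_iff.2 h0
  have hz := hsphere (t⁻¹ • (a, b)) (by
    rw [mem_sphere_zero_iff_norm, norm_smul, norm_inv, norm_norm, inv_mul_cancel₀ ht.ne'])
  have hn : ∀ v : F, ‖t⁻¹ • v‖ ^ p = (t⁻¹) ^ p * ‖v‖ ^ p := fun v => by
    rw [norm_smul, Real.norm_of_nonneg (inv_pos.2 ht).le,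
      Real.mul_rpow (inv_pos.2 ht).le (norm_nonneg v)]
  simp only [gap, Prod.smul_fst, Prod.smul_snd, ← smul_sub, ← smul_add] at hz
  rw [smul_comm (1 / 2 : ℝ) t⁻¹, hn, hn, hn, hn] at hz
  refine le_of_mul_le_mul_left ?_ (Real.rpow_pos_of_pos (inv_pos.2 ht) p)
  linarith

variable {α : Type*} [MeasurableSpace α] {μ : Measure α}

theorem MeasureTheory.Lp.norm_rpow_eq_integral {F : Type*} [NormedAddCommGroup F] (hp : 0 < p)
    (f : Lp F (ENNReal.ofReal p) μ) : ‖f‖ ^ p = ∫ x, ‖f x‖ ^ p ∂μ := by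
  have h0 : 0 ≤ ∫ x, ‖f x‖ ^ p ∂μ := integral_nonneg fun x => by positivity
  rw [Lp.norm_def, (Lp.memLp f).eLpNorm_eq_integral_rpow_norm (by simpa using hp)
    ENNReal.ofReal_ne_top, ENNReal.toReal_ofReal hp.le,
    ENNReal.toReal_ofReal (Real.rpow_nonneg h0 _), Real.rpow_inv_rpow h0 hp.ne']

theorem MeasureTheory.Lp.integrable_norm_rpow' {F : Type*} [NormedAddCommGroup F] (hp : 0 < p)
    (f : Lp F (ENNReal.ofReal p) μ) : Integrable (fun x => ‖f x‖ ^ p) μ := by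
  simpa [ENNReal.toReal_ofReal hp.le] using (Lp.memLp f).integrable_norm_rpow
    (by simpa using hp) ENNReal.ofReal_ne_top

/-- `L_p` is uniformly convex for `1 < p < ∞`. -/
theorem uniformConvexSpace_Lp [ProperSpace F] (hp : 1 < p) [Fact (1 ≤ ENNReal.ofReal p)] :
    UniformConvexSpace (Lp F (ENNReal.ofReal p) μ) := by
  have hp0 : 0 < p := zero_lt_one.trans hp
  refine ⟨fun ε hε => ?_⟩
  have hεp : 0 < ε ^ p := Real.rpow_pos_of_pos hε p
  obtain ⟨C, hC, hCab⟩ := exists_norm_sub_rpow_le (F := F) hp (ε := ε ^ p / 4) (by positivity)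
  set η := max (1 - ε ^ p / (2 * C)) 0
  have hη0 : 0 ≤ η := le_max_right _ _
  have hη1 : η < 1 := max_lt (sub_lt_self _ (by positivity)) one_pos
  have hη : η ^ p⁻¹ < 1 := Real.rpow_lt_one hη0 hη1 (inv_pos.2 hp0)
  refine ⟨2 - 2 * η ^ p⁻¹, by linarith, fun f hf g hg hfg => ?_⟩
  set m : Lp F (ENNReal.ofReal p) μ := (1 / 2 : ℝ) • (f + g)
  have hm : ‖f + g‖ = 2 * ‖m‖ := by
    rw [norm_smul, Real.norm_of_nonneg (by norm_num)]
    ring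
  have If := Lp.integrable_norm_rpow' hp0 f
  have Ig := Lp.integrable_norm_rpow' hp0 g
  have Im := Lp.integrable_norm_rpow' hp0 m
  have key : ‖f - g‖ ^ p ≤ ε ^ p / 4 * (‖f‖ ^ p + ‖g‖ ^ p)
      + C * ((‖f‖ ^ p + ‖g‖ ^ p) / 2 - ‖m‖ ^ p) := by
    have I1 : Integrable (fun x => ‖f x‖ ^ p + ‖g x‖ ^ p) μ := If.add Ig
    have I2 : Integrable (fun x => (‖f x‖ ^ p + ‖g x‖ ^ p) / 2) μ := I1.div_const 2
    have I3 : Integrable (fun x => (‖f x‖ ^ p + ‖g x‖ ^ p) / 2 - ‖m x‖ ^ p) μ := I2.sub Im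
    simp_rw [Lp.norm_rpow_eq_integral hp0]
    rw [← integral_add If Ig, ← integral_const_mul, ← integral_div,
      ← integral_sub I2 Im, ← integral_const_mul,
      ← integral_add (I1.const_mul _) (I3.const_mul _)]
    refine integral_mono_ae (Lp.integrable_norm_rpow' hp0 _)
      ((I1.const_mul _).add (I3.const_mul _)) ?_
    filter_upwards [Lp.coeFn_sub f g, Lp.coeFn_smul (1 / 2 : ℝ) (f + g), Lp.coeFn_add f g]
      with x h1 h2 h3
    have h4 : m x = (1 / 2 : ℝ) • (f x + g x) := by
      rw [h2, Pi.smul_apply, h3, Pi.add_apply]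
    simp only [h1, h4, Pi.sub_apply]
    exact hCab (f x) (g x)
  rw [hf, hg, Real.one_rpow] at key
  have h1 : ε ^ p ≤ ‖f - g‖ ^ p := Real.rpow_le_rpow hε.le hfg hp0.le
  have h2 : ‖m‖ ^ p ≤ η := by
    refine le_max_of_le_left ?_
    rw [le_sub_comm, div_le_iff₀ (by positivity)]
    linarith
  have h3 : ‖m‖ ≤ η ^ p⁻¹ := by
    rw [← Real.rpow_rpow_inv (norm_nonneg m) hp0.ne']
    exact Real.rpow_le_rpow (by positivity) h2 (inv_pos.2 hp0).le
  linarith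

end UniformConvexity

/-- In a uniformly convex space, vectors `f i` of the unit ball that nearly attain the norm of `T`
converge as soon as their images do: if `T (f i) → h` with `‖h‖ = ‖T‖`, then `T` maps the midpoint
of `f i` and `f j` close to `h` too, so the midpoint has norm close to `1`, and uniform convexity
makes `f i` and `f j` close. The limit attains the norm. -/
theorem ContinuousLinearMap.exists_norm_apply_eq_opNorm {𝕜 X Y ι : Type*} [RCLike 𝕜]
    [NormedAddCommGroup X] [NormedSpace 𝕜 X] [NormedSpace ℝ X] [UniformConvexSpace X]
    [CompleteSpace X] [NormedAddCommGroup Y] [NormedSpace 𝕜 Y] (T : X →L[𝕜] Y) (hT : 0 < ‖T‖)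
    {l : Filter ι} [l.NeBot] {f : ι → X} {h : Y} (hf : ∀ i, ‖f i‖ ≤ 1)
    (hTf : Tendsto (fun i => T (f i)) l (𝓝 h)) (hh : ‖h‖ = ‖T‖) :
    ∃ g : X, ‖g‖ = 1 ∧ ‖T g‖ = ‖T‖ := by
  have hcauchy : Cauchy (map f l) := by
    rw [Metric.cauchy_iff]
    refine ⟨inferInstance, fun ε hε => ?_⟩
    obtain ⟨δ, hδ, hδε⟩ := exists_forall_closed_ball_dist_add_le_two_sub X hε
    have hη : 0 < ‖T‖ * δ / 2 := by positivity
    refine ⟨f '' {i | ‖T (f i) - h‖ < ‖T‖ * δ / 2}, image_mem_map ?_, ?_⟩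
    · filter_upwards [Metric.tendsto_nhds.1 hTf _ hη] with i hi
      rwa [dist_eq_norm] at hi
    · rintro _ ⟨i, hi, rfl⟩ _ ⟨j, hj, rfl⟩
      change ‖T (f i) - h‖ < _ at hi
      change ‖T (f j) - h‖ < _ at hj
      by_contra hd
      rw [not_lt, dist_eq_norm] at hd
      have h1 : ‖T‖ * ‖f i + f j‖ ≤ ‖T‖ * (2 - δ) := by
        gcongr
        exact hδε (hf i) (hf j) hd
      have h2 : 2 * ‖h‖ ≤ ‖T (f i + f j)‖ + (‖T (f i) - h‖ + ‖T (f j) - h‖) := by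
        have : h + h = T (f i + f j) - ((T (f i) - h) + (T (f j) - h)) := by
          rw [map_add]; abel
        calc 2 * ‖h‖ = ‖h + h‖ := by
              rw [← two_nsmul, ← Nat.cast_smul_eq_nsmul 𝕜, norm_smul]; simp
          _ ≤ _ := by
            rw [this]
            exact (norm_sub_le _ _).trans (by gcongr; exact norm_add_le _ _)
      have h3 := T.le_opNorm (f i + f j)
      rw [hh] at h2
      linarith
  obtain ⟨g, hg⟩ := CompleteSpace.complete hcauchy
  have hg' : Tendsto f l (𝓝 g) := hg
  have hTg : T g = h := tendsto_nhds_unique ((T.continuous.tendsto g).comp hg') hTf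
  have hg1 : ‖g‖ ≤ 1 := le_of_tendsto hg'.norm (.of_forall hf)
  refine ⟨g, hg1.antisymm ?_, by rw [hTg, hh]⟩
  have := T.le_opNorm g
  rw [hTg, hh] at this
  exact le_of_mul_le_mul_left (by simpa using this) hT

/-! ### Truncation of `L_p` functions -/

section Trunc

variable {α F : Type*} [MeasurableSpace α] {μ : Measure α} [NormedAddCommGroup F] {p : ℝ}

/-- The restriction `f · 1_A` of an element `f` of `L_p` to a measurable set `A`. -/
noncomputable def MeasureTheory.Lp.trunc {p : ℝ≥0∞} {A : Set α} (hA : MeasurableSet A)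
    (f : Lp F p μ) : Lp F p μ :=
  ((Lp.memLp f).indicator hA).toLp (A.indicator f)

namespace MeasureTheory.Lp

theorem coeFn_trunc {p : ℝ≥0∞} {A : Set α} (hA : MeasurableSet A) (f : Lp F p μ) :
    trunc hA f =ᵐ[μ] A.indicator f :=
  MemLp.coeFn_toLp _

theorem norm_trunc_rpow (hp : 0 < p) {A : Set α} (hA : MeasurableSet A)
    (f : Lp F (ENNReal.ofReal p) μ) : ‖trunc hA f‖ ^ p = ∫ x in A, ‖f x‖ ^ p ∂μ := by
  rw [norm_rpow_eq_integral hp, ← integral_indicator hA]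
  refine integral_congr_ae ?_
  filter_upwards [coeFn_trunc hA f] with x hx
  rw [hx]
  by_cases hxA : x ∈ A
  · simp [hxA]
  · simp [hxA, Real.zero_rpow hp.ne']

theorem norm_trunc_le {p : ℝ≥0∞} {A : Set α} (hA : MeasurableSet A) (f : Lp F p μ) :
    ‖trunc hA f‖ ≤ ‖f‖ := by
  refine norm_le_norm_of_ae_le ?_
  filter_upwards [coeFn_trunc hA f] with x hx
  rw [hx]
  exact norm_indicator_le_norm_self _ _

theorem trunc_add_trunc_compl {p : ℝ≥0∞} {A : Set α} (hA : MeasurableSet A) (f : Lp F p μ) :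
    trunc hA f + trunc hA.compl f = f := by
  refine Lp.ext ?_
  filter_upwards [coeFn_add (trunc hA f) (trunc hA.compl f), coeFn_trunc hA f,
    coeFn_trunc hA.compl f] with x h1 h2 h3
  rw [h1, Pi.add_apply, h2, h3, ← Pi.add_apply, Set.indicator_self_add_compl]

/-- A nested pair `A ⊆ B` splits `f` into an inner, an outer and an intermediate part. -/
theorem trunc_add_trunc_add_trunc {p : ℝ≥0∞} {A B : Set α} (hA : MeasurableSet A)
    (hB : MeasurableSet B) (hAB : A ⊆ B) (f : Lp F p μ) :
    trunc hA f + trunc hB.compl f + trunc (hB.diff hA) f = f := by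
  refine Lp.ext ?_
  filter_upwards [coeFn_add (trunc hA f + trunc hB.compl f) (trunc (hB.diff hA) f),
    coeFn_add (trunc hA f) (trunc hB.compl f), coeFn_trunc hA f, coeFn_trunc hB.compl f,
    coeFn_trunc (hB.diff hA) f] with x h1 h2 h3 h4 h5
  rw [h1, Pi.add_apply, h2, Pi.add_apply, h3, h4, h5]
  by_cases hxA : x ∈ A
  · simp [hxA, hAB hxA]
  · by_cases hxB : x ∈ B <;> simp [hxA, hxB]

theorem norm_add_rpow_le_of_disjoint (hp : 0 < p) [Fact (1 ≤ ENNReal.ofReal p)]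
    {f g : Lp F (ENNReal.ofReal p) μ} (hfg : ∀ᵐ x ∂μ, f x = 0 ∨ g x = 0) :
    ‖f + g‖ ^ p ≤ ‖f‖ ^ p + ‖g‖ ^ p := by
  have If := integrable_norm_rpow' hp f
  have Ig := integrable_norm_rpow' hp g
  simp_rw [norm_rpow_eq_integral hp]
  rw [← integral_add If Ig]
  refine integral_mono_ae (integrable_norm_rpow' hp _) (If.add Ig) ?_
  filter_upwards [coeFn_add f g, hfg] with x h1 h2
  simp only [h1, Pi.add_apply]
  rcases h2 with h2 | h2 <;> simp [h2, Real.zero_rpow hp.ne']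

end MeasureTheory.Lp

end Trunc

/-! ### The convolution operator on `L_p` -/

section Operator

variable {d : ℕ} {p q s : ℝ} {k k₀ f g : EuclideanSpace ℝ (Fin d) → ℂ}

theorem convOp_congr_ae (hfg : f =ᵐ[volume] g) : convOp k f = convOp k g := by
  funext x
  rw [convOp_apply, convOp_apply]
  refine integral_congr_ae ?_
  filter_upwards [hfg] with y hy
  rw [hy]

theorem convOp_smul (c : ℂ) : convOp k (c • f) = c • convOp k f := by
  funext x
  rw [Pi.smul_apply, convOp_apply, convOp_apply, smul_eq_mul, ← integral_const_mul]
  congr with y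
  rw [Pi.smul_apply, smul_eq_mul, mul_left_comm]

theorem YoungExponents.convOp_add (h : YoungExponents p q s)
    (hk : MemLp k (ENNReal.ofReal q) volume) (hf : MemLp f (ENNReal.ofReal p) volume)
    (hg : MemLp g (ENNReal.ofReal p) volume) :
    convOp k (f + g) =ᵐ[volume] convOp k f + convOp k g := by
  filter_upwards [h.ae_integrable hk hf, h.ae_integrable hk hg] with x hx hx'
  simp only [Pi.add_apply, convOp_apply, ← integral_add hx hx', mul_add]

theorem YoungExponents.convOp_sub_kernel (h : YoungExponents p q s)
    (hk : MemLp k (ENNReal.ofReal q) volume) (hk₀ : MemLp k₀ (ENNReal.ofReal q) volume)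
    (hf : MemLp f (ENNReal.ofReal p) volume) :
    convOp (k - k₀) f =ᵐ[volume] convOp k f - convOp k₀ f := by
  filter_upwards [h.ae_integrable hk hf, h.ae_integrable hk₀ hf] with x hx hx'
  simp only [Pi.sub_apply, convOp_apply, ← integral_sub hx hx', sub_mul]

theorem convOp_translate (x₀ x : EuclideanSpace ℝ (Fin d)) :
    convOp k (fun y => f (y + x₀)) x = convOp k f (x + x₀) := by
  rw [convOp_apply, convOp_apply,
    ← integral_add_right_eq_self (fun y => k (x + x₀ - y) * f y) x₀]
  simp only [add_sub_add_right_eq_sub]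

variable [Fact (1 ≤ ENNReal.ofReal p)] [Fact (1 ≤ ENNReal.ofReal s)]

/-- Convolution by `k ∈ L_q` as a bounded operator from `L_p` to `L_s`. -/
noncomputable def convLp (h : YoungExponents p q s) (hk : MemLp k (ENNReal.ofReal q) volume) :
    Lp ℂ (ENNReal.ofReal p) (volume : Measure (EuclideanSpace ℝ (Fin d))) →L[ℂ]
      Lp ℂ (ENNReal.ofReal s) (volume : Measure (EuclideanSpace ℝ (Fin d))) :=
  LinearMap.mkContinuous
    { toFun := fun f => (h.memLp_convOp hk (Lp.memLp f)).toLp (convOp k f)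
      map_add' := fun f g => by
        rw [← MemLp.toLp_add]
        refine MemLp.toLp_congr _ _ ?_
        rw [convOp_congr_ae (Lp.coeFn_add f g)]
        exact h.convOp_add hk (Lp.memLp f) (Lp.memLp g)
      map_smul' := fun c f => by
        rw [RingHom.id_apply, ← MemLp.toLp_const_smul]
        refine MemLp.toLp_congr _ _ ?_
        rw [convOp_congr_ae (Lp.coeFn_smul c f), convOp_smul] }
    (eLpNorm k (ENNReal.ofReal q) volume).toReal
    (fun f => by
      rw [LinearMap.coe_mk, AddHom.coe_mk, Lp.norm_toLp, Lp.norm_def, ← ENNReal.toReal_mul]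
      exact ENNReal.toReal_mono (ENNReal.mul_lt_top hk.2 (Lp.memLp f).2).ne
        (h.eLpNorm_convOp_le hk.1 (Lp.memLp f).1))

theorem coeFn_convLp (h : YoungExponents p q s) (hk : MemLp k (ENNReal.ofReal q) volume)
    (u : Lp ℂ (ENNReal.ofReal p) (volume : Measure (EuclideanSpace ℝ (Fin d)))) :
    convLp h hk u =ᵐ[volume] convOp k u :=
  (h.memLp_convOp hk (Lp.memLp u)).coeFn_toLp

theorem enorm_convLp (h : YoungExponents p q s) (hk : MemLp k (ENNReal.ofReal q) volume)
    (u : Lp ℂ (ENNReal.ofReal p) (volume : Measure (EuclideanSpace ℝ (Fin d)))) :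
    ‖convLp h hk u‖ₑ = eLpNorm (convOp k u) (ENNReal.ofReal s) volume := by
  rw [Lp.enorm_def, eLpNorm_congr_ae (coeFn_convLp h hk u)]

theorem norm_convLp_le (h : YoungExponents p q s) (hk : MemLp k (ENNReal.ofReal q) volume) :
    ‖convLp h hk‖ ≤ (eLpNorm k (ENNReal.ofReal q) volume).toReal :=
  LinearMap.mkContinuous_norm_le _ ENNReal.toReal_nonneg _

theorem convLp_sub (h : YoungExponents p q s) (hk : MemLp k (ENNReal.ofReal q) volume)
    (hk₀ : MemLp k₀ (ENNReal.ofReal q) volume) :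
    convLp h hk - convLp h hk₀ = convLp h (hk.sub hk₀) := by
  ext1 u
  refine Lp.ext ?_
  rw [sub_apply]
  filter_upwards [Lp.coeFn_sub (convLp h hk u) (convLp h hk₀ u), coeFn_convLp h hk u,
    coeFn_convLp h hk₀ u, coeFn_convLp h (hk.sub hk₀) u,
    h.convOp_sub_kernel hk hk₀ (Lp.memLp u)] with x h1 h2 h3 h4 h5
  rw [h1, Pi.sub_apply, h2, h3, h4, h5, Pi.sub_apply]

theorem convOpNorm_eq_enorm (h : YoungExponents p q s) (hk : MemLp k (ENNReal.ofReal q) volume) :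
    convOpNorm k (ENNReal.ofReal p) (ENNReal.ofReal s) = ‖convLp h hk‖ₑ := by
  have hle : convOpNorm k (ENNReal.ofReal p) (ENNReal.ofReal s) ≤ ‖convLp h hk‖ₑ := by
    refine iSup_le fun f => iSup_le fun hf => iSup_le fun hf1 => ?_
    rw [← convOp_congr_ae hf.coeFn_toLp, ← enorm_convLp h hk]
    refine ((convLp h hk).le_opENorm _).trans ?_
    rw [Lp.enorm_toLp]
    exact mul_le_of_le_one_right' hf1
  refine hle.antisymm ?_
  have hfin : convOpNorm k (ENNReal.ofReal p) (ENNReal.ofReal s) ≠ ⊤ :=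
    (hle.trans_lt enorm_lt_top).ne
  rw [← ofReal_norm, ← ENNReal.ofReal_toReal hfin]
  refine ENNReal.ofReal_le_ofReal
    (ContinuousLinearMap.opNorm_le_of_unit_norm ENNReal.toReal_nonneg fun u hu => ?_)
  rw [← toReal_enorm]
  refine ENNReal.toReal_mono hfin ?_
  rw [enorm_convLp]
  refine le_iSup_of_le (u : EuclideanSpace ℝ (Fin d) → ℂ)
    (le_iSup_of_le (Lp.memLp u) (le_iSup_of_le ?_ le_rfl))
  rw [← Lp.enorm_def, ← ofReal_norm, hu, ENNReal.ofReal_one]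

/-- In operator norm, convolutions are approximated by convolutions with continuous compactly
supported kernels. -/
theorem exists_continuous_norm_convLp_sub_le (h : YoungExponents p q s)
    (hk : MemLp k (ENNReal.ofReal q) volume) {η : ℝ} (hη : 0 < η) :
    ∃ (k₀ : EuclideanSpace ℝ (Fin d) → ℂ) (hk₀ : MemLp k₀ (ENNReal.ofReal q) volume) (ρ : ℝ),
      Continuous k₀ ∧ HasCompactSupport k₀ ∧ 0 ≤ ρ ∧ (∀ x, ρ < ‖x‖ → k₀ x = 0) ∧
        ‖convLp h hk - convLp h hk₀‖ ≤ η := by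
  obtain ⟨k₀, hcs, hle, hcont, hk₀⟩ := hk.exists_hasCompactSupport_eLpNorm_sub_le
    ENNReal.ofReal_ne_top (ε := ENNReal.ofReal η) (by simpa using hη)
  obtain ⟨ρ, hρ⟩ := hcs.isCompact.isBounded.subset_closedBall 0
  refine ⟨k₀, hk₀, max ρ 0, hcont, hcs, le_max_right _ _, fun x hx => ?_, ?_⟩
  · by_contra hne
    have h1 := mem_closedBall_zero_iff.1 (hρ (subset_tsupport _ hne))
    exact absurd ((le_max_left ρ 0).trans_lt hx) h1.not_gt
  · rw [convLp_sub]
    exact (norm_convLp_le h _).trans (ENNReal.toReal_le_of_le_ofReal hη.le hle)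

/-! ### Maximizing sequences do not vanish -/

/-- The local form of Young's inequality: for a kernel supported in a ball of radius `ρ`, the image
of `f` is small if `f` is small on every ball of radius `ρ`. -/
theorem norm_convLp_rpow_le (h : YoungExponents p q s) (hk : MemLp k (ENNReal.ofReal q) volume)
    {ρ : ℝ} (hkρ : ∀ x, ρ < ‖x‖ → k x = 0) {c : ℝ} (hc : 0 ≤ c)
    (u : Lp ℂ (ENNReal.ofReal p) (volume : Measure (EuclideanSpace ℝ (Fin d))))
    (hu : ∀ x, ‖Lp.trunc (measurableSet_closedBall (x := x) (ε := ρ)) u‖ ≤ c) :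
    ‖convLp h hk u‖ ^ s ≤
      (eLpNorm k (ENNReal.ofReal q) volume).toReal ^ s * ‖u‖ ^ p * c ^ (s - p) := by
  have key := (eLpNorm_convOp_rpow_le (k := k) (f := u) h.pos).trans
    (h.lintegral_conv_rpow_le hk.1 (Lp.memLp u).1 (S := fun x => closedBall x ρ)
      (fun x => measurableSet_closedBall)
      (fun x y hy => hkρ _ (by
        rwa [mem_closedBall, dist_comm, dist_eq_norm, not_le] at hy))
      (c := ENNReal.ofReal c) (fun x => by
        rw [← eLpNorm_congr_ae (Lp.coeFn_trunc measurableSet_closedBall u), ← Lp.enorm_def,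
          ← ofReal_norm]
        exact ENNReal.ofReal_le_ofReal (hu x)))
  rw [← enorm_convLp h hk, ← Lp.enorm_def, ← ofReal_norm, ← ofReal_norm,
    ← ENNReal.ofReal_toReal hk.2.ne,
    ENNReal.ofReal_rpow_of_nonneg (norm_nonneg _) h.pos.le,
    ENNReal.ofReal_rpow_of_nonneg (norm_nonneg _) h.left_pos.le,
    ENNReal.ofReal_rpow_of_nonneg ENNReal.toReal_nonneg h.pos.le,
    ENNReal.ofReal_rpow_of_nonneg hc (sub_nonneg.2 h.left_lt.le),
    ← ENNReal.ofReal_mul (by positivity), ← ENNReal.ofReal_mul (by positivity)] at key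
  exact (ENNReal.ofReal_le_ofReal_iff (by positivity)).1 key

theorem exists_le_norm_trunc_closedBall (h : YoungExponents p q s)
    (hk : MemLp k (ENNReal.ofReal q) volume) (hM : 0 < ‖convLp h hk‖) :
    ∃ ρ c : ℝ, 0 < c ∧
      ∀ u : Lp ℂ (ENNReal.ofReal p) (volume : Measure (EuclideanSpace ℝ (Fin d))), ‖u‖ ≤ 1 →
        ‖convLp h hk‖ / 2 ≤ ‖convLp h hk u‖ →
          ∃ x, c ≤ ‖Lp.trunc (measurableSet_closedBall (x := x) (ε := ρ)) u‖ := by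
  set M := ‖convLp h hk‖
  obtain ⟨k₀, hk₀, ρ, -, -, -, hkρ, hle⟩ :=
    exists_continuous_norm_convLp_sub_le h hk (η := M / 4) (by positivity)
  set a := (eLpNorm k₀ (ENNReal.ofReal q) volume).toReal ^ s
  have ha : 0 ≤ a := by positivity
  set b := (M / 4) ^ s
  have hb : 0 < b := by positivity
  have hsp : 0 < s - p := sub_pos.2 h.left_lt
  -- `c` is chosen so that `a * c ^ (s - p) < b`
  refine ⟨ρ, (b / (a + 1)) ^ (s - p)⁻¹, by positivity, fun u hu hTu => ?_⟩
  by_contra! hcon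
  have h1 := norm_convLp_rpow_le h hk₀ hkρ (by positivity) u fun x => (hcon x).le
  rw [Real.rpow_inv_rpow (by positivity) hsp.ne'] at h1
  have h2 : a * ‖u‖ ^ p * (b / (a + 1)) ≤ a * 1 * (b / (a + 1)) := by
    gcongr
    exact Real.rpow_le_one (norm_nonneg u) hu h.left_pos.le
  have h3 : a * 1 * (b / (a + 1)) < b := by
    rw [mul_one, mul_div_assoc', div_lt_iff₀ (by positivity)]
    linarith
  have h4 : ‖convLp h hk₀ u‖ < M / 4 :=
    (Real.rpow_lt_rpow_iff (norm_nonneg _) (by positivity) h.pos).1 ((h1.trans h2).trans_lt h3)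
  have h5 : ‖convLp h hk u - convLp h hk₀ u‖ ≤ M / 4 := by
    rw [← sub_apply]
    exact ContinuousLinearMap.le_of_opNorm_le_of_le _ hle hu |>.trans_eq (mul_one _)
  have h6 := norm_le_insert' (convLp h hk u) (convLp h hk₀ u)
  linarith

/-- Translating so that a prescribed point becomes the origin changes neither `‖u‖` nor the norm of
the image of `u`. -/
theorem exists_translate (h : YoungExponents p q s) (hk : MemLp k (ENNReal.ofReal q) volume)
    (u : Lp ℂ (ENNReal.ofReal p) (volume : Measure (EuclideanSpace ℝ (Fin d))))
    (x₀ : EuclideanSpace ℝ (Fin d)) (ρ : ℝ) :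
    ∃ v : Lp ℂ (ENNReal.ofReal p) (volume : Measure (EuclideanSpace ℝ (Fin d))),
      ‖v‖ = ‖u‖ ∧ ‖convLp h hk v‖ = ‖convLp h hk u‖ ∧
        ‖Lp.trunc (measurableSet_closedBall (x := 0) (ε := ρ)) v‖ =
          ‖Lp.trunc (measurableSet_closedBall (x := x₀) (ε := ρ)) u‖ := by
  have hmp : MeasurePreserving (fun y : EuclideanSpace ℝ (Fin d) => y + x₀) volume volume :=
    measurePreserving_add_right volume x₀
  have hcoe := Lp.coeFn_compMeasurePreserving u hmp
  refine ⟨Lp.compMeasurePreserving _ hmp u, Lp.norm_compMeasurePreserving u hmp, ?_, ?_⟩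
  · have : convLp h hk (Lp.compMeasurePreserving _ hmp u) =
        Lp.compMeasurePreserving _ hmp (convLp h hk u) := by
      refine Lp.ext ?_
      filter_upwards [coeFn_convLp h hk (Lp.compMeasurePreserving _ hmp u),
        Lp.coeFn_compMeasurePreserving (convLp h hk u) hmp,
        hmp.quasiMeasurePreserving.ae (coeFn_convLp h hk u)] with x h1 h2 h3
      rw [h1, h2, Function.comp_apply, h3, convOp_congr_ae hcoe]
      exact convOp_translate x₀ x
    rw [this, Lp.norm_compMeasurePreserving]
  · refine (Real.rpow_left_inj (norm_nonneg _) (norm_nonneg _) h.left_pos.ne').1 ?_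
    rw [Lp.norm_trunc_rpow h.left_pos, Lp.norm_trunc_rpow h.left_pos,
      ← hmp.setIntegral_preimage_emb (measurableEmbedding_addRight x₀) (fun y => ‖u y‖ ^ p)]
    have : (fun y => y + x₀) ⁻¹' closedBall x₀ ρ = closedBall 0 ρ := by
      ext y; simp
    rw [this]
    refine integral_congr_ae (ae_restrict_of_ae ?_)
    filter_upwards [hcoe] with y hy
    rw [hy, Function.comp_apply]

end Operator

/-! ### Maximizing sequences do not split -/

section Tightness

variable {d : ℕ} {p q s : ℝ} {k : EuclideanSpace ℝ (Fin d) → ℂ}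
  [Fact (1 ≤ ENNReal.ofReal p)] [Fact (1 ≤ ENNReal.ofReal s)]

theorem convOp_indicator_eq_zero {A : Set (EuclideanSpace ℝ (Fin d))}
    {f : EuclideanSpace ℝ (Fin d) → ℂ} {x : EuclideanSpace ℝ (Fin d)}
    (hA : ∀ y ∈ A, k (x - y) = 0) : convOp k (A.indicator f) x = 0 := by
  rw [convOp_apply]
  refine integral_eq_zero_of_ae (.of_forall fun y => ?_)
  by_cases hy : y ∈ A
  · simp [hA y hy]
  · simp [hy]

theorem coeFn_convLp_trunc (h : YoungExponents p q s) (hk : MemLp k (ENNReal.ofReal q) volume)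
    {A : Set (EuclideanSpace ℝ (Fin d))} (hA : MeasurableSet A)
    (u : Lp ℂ (ENNReal.ofReal p) (volume : Measure (EuclideanSpace ℝ (Fin d)))) :
    convLp h hk (Lp.trunc hA u) =ᵐ[volume] convOp k (A.indicator u) := by
  rw [← convOp_congr_ae (Lp.coeFn_trunc hA u)]
  exact coeFn_convLp h hk _

/-- If the kernel is supported in a ball of radius `ρ`, the images of two functions at distance
`2ρ` have disjoint supports. -/
theorem norm_convLp_trunc_add_rpow_le (h : YoungExponents p q s)
    (hk : MemLp k (ENNReal.ofReal q) volume) {ρ : ℝ} (hkρ : ∀ x, ρ < ‖x‖ → k x = 0) (a : ℝ)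
    (u : Lp ℂ (ENNReal.ofReal p) (volume : Measure (EuclideanSpace ℝ (Fin d)))) :
    ‖convLp h hk (Lp.trunc (measurableSet_closedBall (x := 0) (ε := a)) u +
        Lp.trunc (measurableSet_closedBall (x := 0) (ε := a + 2 * ρ)).compl u)‖ ^ s ≤
      ‖convLp h hk (Lp.trunc (measurableSet_closedBall (x := 0) (ε := a)) u)‖ ^ s +
      ‖convLp h hk
        (Lp.trunc (measurableSet_closedBall (x := 0) (ε := a + 2 * ρ)).compl u)‖ ^ s := by
  rw [map_add]
  refine Lp.norm_add_rpow_le_of_disjoint h.pos ?_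
  filter_upwards [coeFn_convLp_trunc h hk (measurableSet_closedBall (x := 0) (ε := a)) u,
    coeFn_convLp_trunc h hk (measurableSet_closedBall (x := 0) (ε := a + 2 * ρ)).compl u]
    with x h1 h2
  rw [h1, h2]
  by_cases hx : ‖x‖ ≤ a + ρ
  · refine .inr (convOp_indicator_eq_zero fun y hy => hkρ _ ?_)
    rw [Set.mem_compl_iff, mem_closedBall_zero_iff, not_le] at hy
    have := norm_sub_norm_le y x
    rw [norm_sub_rev] at this
    linarith
  · refine .inl (convOp_indicator_eq_zero fun y hy => hkρ _ ?_)
    rw [mem_closedBall_zero_iff] at hy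
    have := norm_sub_norm_le x y
    linarith

/-- The integral of `‖f‖ ^ p` over the increasing balls of radii `a + b * j` cannot grow
substantially at each of `N` steps. -/
theorem exists_norm_trunc_annulus_le (hp : 0 < p) {b : ℝ} (hb : 0 ≤ b) (a : ℝ) {η : ℝ}
    (hη : 0 < η) : ∃ N : ℕ,
      ∀ u : Lp ℂ (ENNReal.ofReal p) (volume : Measure (EuclideanSpace ℝ (Fin d))), ‖u‖ ≤ 1 →
        ∃ j < N, ‖Lp.trunc ((measurableSet_closedBall (x := 0) (ε := a + b * j + b)).diff
          (measurableSet_closedBall (x := 0) (ε := a + b * j))) u‖ ≤ η := by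
  obtain ⟨n, hn⟩ := exists_nat_one_div_lt (Real.rpow_pos_of_pos hη p)
  refine ⟨n + 1, fun u hu => ?_⟩
  set I : ℕ → ℝ := fun j => ∫ x in closedBall 0 (a + b * j), ‖u x‖ ^ p
  have Iu := Lp.integrable_norm_rpow' hp u
  have hI0 : 0 ≤ I 0 := integral_nonneg fun x => by positivity
  have hI1 : I (n + 1) ≤ 1 :=
    (setIntegral_le_integral Iu (.of_forall fun x => by positivity)).trans
      ((Lp.norm_rpow_eq_integral hp u).symm.trans_le
        (Real.rpow_le_one (norm_nonneg u) hu hp.le))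
  obtain ⟨j, hj, hjle⟩ : ∃ j ∈ Finset.range (n + 1), I (j + 1) - I j ≤ 1 / ((n : ℝ) + 1) := by
    refine Finset.exists_le_of_sum_le ⟨0, by simp⟩ ?_
    rw [Finset.sum_range_sub, Finset.sum_const, Finset.card_range, nsmul_eq_mul]
    push_cast
    rw [mul_one_div_cancel (by positivity)]
    linarith
  refine ⟨j, Finset.mem_range.1 hj, ?_⟩
  refine (Real.rpow_le_rpow_iff (norm_nonneg _) hη.le hp).1 ?_
  have e : a + b * j + b = a + b * ((j + 1 : ℕ) : ℝ) := by push_cast; ring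
  rw [Lp.norm_trunc_rpow hp, e, setIntegral_sdiff measurableSet_closedBall Iu.integrableOn
    (closedBall_subset_closedBall (by push_cast; linarith))]
  exact hjle.trans hn.le

/-- Tightness of near-maximizers: if `u` has norm at most `1`, nearly attains the norm of the
operator, and carries a fixed amount of mass near the origin, then almost all its mass lies in a
fixed ball. Indeed `u` has little mass on some annulus; up to small errors the operator acts on
the inner and the outer part of `u` independently, and, since `p < s`, the operator norm can be
nearly attained only if one of the two parts carries almost all the mass. -/
theorem exists_norm_trunc_compl_closedBall_le (h : YoungExponents p q s)
    (hk : MemLp k (ENNReal.ofReal q) volume) (hM : 0 < ‖convLp h hk‖) (r : ℝ) {c ε : ℝ}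
    (hc : 0 < c) (hε : 0 < ε) :
    ∃ δ : ℝ, 0 < δ ∧ ∃ R : ℝ,
      ∀ u : Lp ℂ (ENNReal.ofReal p) (volume : Measure (EuclideanSpace ℝ (Fin d))), ‖u‖ ≤ 1 →
        ‖convLp h hk‖ - δ ≤ ‖convLp h hk u‖ →
          c ≤ ‖Lp.trunc (measurableSet_closedBall (x := 0) (ε := r)) u‖ →
            ‖Lp.trunc (measurableSet_closedBall (x := 0) (ε := R)).compl u‖ ≤ ε := by
  have hp := h.left_pos
  have hs := h.pos
  have hsp : 0 < s - p := sub_pos.2 h.left_lt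
  set M := ‖convLp h hk‖
  -- one of the two parts has norm at least `θ`; this must be the inner one since `θ ^ p > 1 - c ^ p`
  obtain ⟨θ, hθ0, hθ1, hθε, hθc⟩ :
      ∃ θ : ℝ, 0 < θ ∧ θ < 1 ∧ 1 - ε ^ p ≤ θ ^ p ∧ 1 - c ^ p < θ ^ p := by
    have hlim : Tendsto (fun θ : ℝ => θ ^ p) (𝓝[<] 1) (𝓝 1) := by
      have := (Real.continuousAt_rpow_const 1 p (.inl one_ne_zero)).tendsto
      rw [Real.one_rpow] at this
      exact this.mono_left nhdsWithin_le_nhds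
    have e1 : 1 - ε ^ p < 1 := sub_lt_self _ (by positivity)
    have e2 : 1 - c ^ p < 1 := sub_lt_self _ (by positivity)
    obtain ⟨θ, h1, h2, h3, h4⟩ := ((hlim.eventually_const_lt e1).and
      ((hlim.eventually_const_lt e2).and
        (((lt_mem_nhds one_pos).filter_mono nhdsWithin_le_nhds).and
          self_mem_nhdsWithin))).exists
    exact ⟨θ, h3, h4, h1.le, h2⟩
  set γ := (s - p) / s
  have hγ : 0 < γ := div_pos hsp hs
  -- if both parts had norm below `θ`, the image would have norm at most the left-hand side, by the
  -- disjointness of supports and the errors of approximating `k` and of dropping the annulus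
  obtain ⟨η, hη, hηM⟩ : ∃ η : ℝ, 0 < η ∧ (M + η) * θ ^ γ + η + M * η < M - η := by
    have hlim : Tendsto (fun η : ℝ => (M + η) * θ ^ γ + η + M * η + η) (𝓝[>] 0)
        (𝓝 (M * θ ^ γ)) := by
      have : Continuous fun η : ℝ => (M + η) * θ ^ γ + η + M * η + η := by fun_prop
      have := this.tendsto 0
      simp only [add_zero, mul_zero] at this
      exact this.mono_left nhdsWithin_le_nhds
    have e1 : M * θ ^ γ < M := mul_lt_of_lt_one_right hM (Real.rpow_lt_one hθ0.le hθ1 hγ)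
    obtain ⟨η, h1, h2⟩ := ((hlim.eventually_lt_const e1).and self_mem_nhdsWithin).exists
    exact ⟨η, h2, by linarith⟩
  obtain ⟨k₀, hk₀, ρ, -, -, hρ, hkρ, hle⟩ := exists_continuous_norm_convLp_sub_le h hk hη
  obtain ⟨N, hN⟩ := exists_norm_trunc_annulus_le (d := d) hp (b := 2 * ρ) (by positivity) r hη
  refine ⟨η, hη, r + 2 * ρ * N, fun u hu hTu hcu => ?_⟩
  obtain ⟨j, hjN, hj⟩ := hN u hu
  set R := r + 2 * ρ * j
  have hrR : r ≤ R := le_add_of_nonneg_right (by positivity)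
  have hRN : R ≤ r + 2 * ρ * N := by
    have : (j : ℝ) ≤ N := by exact_mod_cast hjN.le
    simp only [R]
    gcongr
  have hRR : R ≤ R + 2 * ρ := le_add_of_nonneg_right (by positivity)
  set v := Lp.trunc (measurableSet_closedBall (x := 0) (ε := R)) u
  set w := Lp.trunc (measurableSet_closedBall (x := 0) (ε := R + 2 * ρ)).compl u
  set z := Lp.trunc ((measurableSet_closedBall (x := 0) (ε := R + 2 * ρ)).diff
    (measurableSet_closedBall (x := 0) (ε := R))) u
  have huvw : v + w + z = u := Lp.trunc_add_trunc_add_trunc measurableSet_closedBall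
    measurableSet_closedBall (closedBall_subset_closedBall hRR) u
  have Iu := Lp.integrable_norm_rpow' hp u
  have hI1 : ∫ x, ‖u x‖ ^ p ≤ 1 :=
    (Lp.norm_rpow_eq_integral hp u).symm.trans_le (Real.rpow_le_one (norm_nonneg u) hu hp.le)
  have hnn : ∀ A : Set (EuclideanSpace ℝ (Fin d)),
      0 ≤ᵐ[volume.restrict A] fun x => ‖u x‖ ^ p := fun A => .of_forall fun x => by positivity
  have hsplit := integral_add_compl (measurableSet_closedBall (x := 0) (ε := R)) Iu
  have hvw : ‖v‖ ^ p + ‖w‖ ^ p ≤ 1 := by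
    rw [Lp.norm_trunc_rpow hp, Lp.norm_trunc_rpow hp]
    have : ∫ x in (closedBall 0 (R + 2 * ρ))ᶜ, ‖u x‖ ^ p ≤
        ∫ x in (closedBall 0 R)ᶜ, ‖u x‖ ^ p :=
      setIntegral_mono_set Iu.integrableOn (hnn _)
        (Set.compl_subset_compl.2 (closedBall_subset_closedBall hRR)).eventuallyLE
    linarith
  have hcv : c ^ p ≤ ‖v‖ ^ p := by
    refine (Real.rpow_le_rpow hc.le hcu hp.le).trans ?_
    rw [Lp.norm_trunc_rpow hp, Lp.norm_trunc_rpow hp]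
    exact setIntegral_mono_set Iu.integrableOn (hnn _)
      (closedBall_subset_closedBall hrR).eventuallyLE
  have hv0 : 0 ≤ ‖v‖ ^ p := by positivity
  have hw0 : 0 ≤ ‖w‖ ^ p := by positivity
  have hθv : θ ≤ ‖v‖ := by
    by_contra! hvθ
    have hwθ : ‖w‖ < θ := by
      by_contra! hwθ
      have := Real.rpow_le_rpow hθ0.le hwθ hp.le
      linarith
    have hpart : ∀ x : Lp ℂ (ENNReal.ofReal p) (volume : Measure (EuclideanSpace ℝ (Fin d))),
        ‖x‖ ≤ θ → ‖convLp h hk₀ x‖ ^ s ≤ (M + η) ^ s * θ ^ (s - p) * ‖x‖ ^ p := by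
      intro x hx
      have h1 : ‖convLp h hk₀ x‖ ≤ (M + η) * ‖x‖ := by
        refine ContinuousLinearMap.le_of_opNorm_le _ ?_ x
        have := norm_le_insert (convLp h hk) (convLp h hk₀)
        linarith
      have h2 : ‖x‖ ^ s = ‖x‖ ^ (s - p) * ‖x‖ ^ p := by
        rw [← Real.rpow_add_of_nonneg (norm_nonneg x) hsp.le hp.le, sub_add_cancel]
      calc ‖convLp h hk₀ x‖ ^ s ≤ ((M + η) * ‖x‖) ^ s :=
            Real.rpow_le_rpow (norm_nonneg _) h1 hs.le
        _ = (M + η) ^ s * ‖x‖ ^ (s - p) * ‖x‖ ^ p := by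
            rw [Real.mul_rpow (by positivity) (norm_nonneg x), h2, mul_assoc]
        _ ≤ (M + η) ^ s * θ ^ (s - p) * ‖x‖ ^ p := by gcongr
    have h1 : ‖convLp h hk₀ (v + w)‖ ^ s ≤ ((M + η) * θ ^ γ) ^ s := by
      have h2 : (M + η) ^ s * θ ^ (s - p) * (‖v‖ ^ p + ‖w‖ ^ p) ≤
          (M + η) ^ s * θ ^ (s - p) * 1 := by gcongr
      rw [Real.mul_rpow (by positivity) (by positivity), ← Real.rpow_mul hθ0.le,
        div_mul_cancel₀ _ hs.ne']
      have h3 := norm_convLp_trunc_add_rpow_le h hk₀ hkρ R u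
      have h4 := hpart v hvθ.le
      have h5 := hpart w hwθ.le
      calc ‖convLp h hk₀ (v + w)‖ ^ s ≤ ‖convLp h hk₀ v‖ ^ s + ‖convLp h hk₀ w‖ ^ s := h3
        _ ≤ _ := by linarith
    have h2 : ‖convLp h hk₀ (v + w)‖ ≤ (M + η) * θ ^ γ :=
      (Real.rpow_le_rpow_iff (norm_nonneg _) (by positivity) hs).1 h1
    have h3 : ‖v + w‖ ≤ 1 := by
      refine (Real.rpow_le_rpow_iff (norm_nonneg _) zero_le_one hp).1 ?_
      rw [Real.one_rpow]
      refine (Lp.norm_add_rpow_le_of_disjoint hp ?_).trans hvw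
      filter_upwards [Lp.coeFn_trunc (measurableSet_closedBall (x := 0) (ε := R)) u,
        Lp.coeFn_trunc (measurableSet_closedBall (x := 0) (ε := R + 2 * ρ)).compl u]
        with x hx1 hx2
      rw [hx1, hx2]
      by_cases hx : x ∈ closedBall 0 R
      · have := closedBall_subset_closedBall hRR hx
        exact .inr (Set.indicator_of_notMem (Set.notMem_compl_iff.2 this) _)
      · exact .inl (Set.indicator_of_notMem hx _)
    have h4 : ‖convLp h hk (v + w) - convLp h hk₀ (v + w)‖ ≤ η := by
      rw [← sub_apply]
      exact (ContinuousLinearMap.le_of_opNorm_le_of_le _ hle h3).trans_eq (mul_one _)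
    have h5 : ‖convLp h hk z‖ ≤ M * η :=
      ContinuousLinearMap.le_of_opNorm_le_of_le _ le_rfl hj
    have h6 : ‖convLp h hk u‖ ≤ ‖convLp h hk (v + w)‖ + ‖convLp h hk z‖ := by
      rw [← huvw, map_add]
      exact norm_add_le _ _
    have h7 := norm_le_insert' (convLp h hk (v + w)) (convLp h hk₀ (v + w))
    linarith
  refine (Real.rpow_le_rpow_iff (norm_nonneg _) hε.le hp).1 ?_
  have h1 := Real.rpow_le_rpow hθ0.le hθv hp.le
  rw [Lp.norm_trunc_rpow hp] at h1 ⊢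
  have h2 : ∫ x in (closedBall 0 (r + 2 * ρ * N))ᶜ, ‖u x‖ ^ p ≤
      ∫ x in (closedBall 0 R)ᶜ, ‖u x‖ ^ p :=
    setIntegral_mono_set Iu.integrableOn (hnn _)
      (Set.compl_subset_compl.2 (closedBall_subset_closedBall hRN)).eventuallyLE
  linarith

end Tightness

/-! ### Local compactness of convolution operators -/

section Compactness

variable {d : ℕ} {p q s : ℝ} {k : EuclideanSpace ℝ (Fin d) → ℂ}

theorem integrableOn_norm_closedBall (hp : 1 < p) (R : ℝ)
    (u : Lp ℂ (ENNReal.ofReal p) (volume : Measure (EuclideanSpace ℝ (Fin d)))) :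
    IntegrableOn (fun x => ‖u x‖) (closedBall 0 R) volume ∧
      ∫ x in closedBall 0 R, ‖u x‖ ≤
        volume.real (closedBall (0 : EuclideanSpace ℝ (Fin d)) R) + ‖u‖ ^ p := by
  have hp0 : 0 < p := zero_lt_one.trans hp
  have Iu := Lp.integrable_norm_rpow' hp0 u
  have hI : IntegrableOn (fun x => 1 + ‖u x‖ ^ p) (closedBall 0 R) volume :=
    (integrableOn_const measure_closedBall_lt_top.ne).add Iu.integrableOn
  have hle : ∀ t : ℝ, 0 ≤ t → t ≤ 1 + t ^ p := fun t ht => by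
    rcases le_total t 1 with h1 | h1
    · have := Real.rpow_nonneg ht p
      linarith
    · have := Real.self_le_rpow_of_one_le h1 hp.le
      linarith
  have hI' : IntegrableOn (fun x => ‖u x‖) (closedBall 0 R) volume :=
    Integrable.mono' hI (Lp.memLp u).1.norm.restrict
      (.of_forall fun x => by simpa using hle _ (norm_nonneg (u x)))
  refine ⟨hI', (integral_mono hI' hI fun x => hle _ (norm_nonneg (u x))).trans ?_⟩
  have hconst : IntegrableOn (fun _ => (1 : ℝ)) (closedBall (0 : EuclideanSpace ℝ (Fin d)) R)
      volume := integrableOn_const measure_closedBall_lt_top.ne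
  rw [integral_add hconst Iu.integrableOn, setIntegral_const, smul_eq_mul, mul_one,
    Lp.norm_rpow_eq_integral hp0]
  gcongr
  · exact .of_forall fun x => by positivity
  · exact Measure.restrict_le_self

variable [Fact (1 ≤ ENNReal.ofReal p)] [Fact (1 ≤ ENNReal.ofReal s)]

/-- A kernel that is continuous with compact support turns bounded sequences supported in a ball
into convergent ones along any ultrafilter: the images form a bounded equicontinuous family with
supports in a common ball, so that pointwise convergence, which the ultrafilter gives for free, is
uniform. -/
theorem exists_tendsto_convLp_trunc (h : YoungExponents p q s)
    (hk : MemLp k (ENNReal.ofReal q) volume)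
    (hcont : Continuous k) (hcs : HasCompactSupport k) {ρ : ℝ} (hkρ : ∀ x, ρ < ‖x‖ → k x = 0)
    (R : ℝ) {ι : Type*} (U : Ultrafilter ι)
    {u : ι → Lp ℂ (ENNReal.ofReal p) (volume : Measure (EuclideanSpace ℝ (Fin d)))}
    (hu : ∀ i, ‖u i‖ ≤ 1) :
    ∃ g, Tendsto (fun i => convLp h hk (Lp.trunc (measurableSet_closedBall (x := 0) (ε := R))
      (u i))) U (𝓝 g) := by
  set B : Set (EuclideanSpace ℝ (Fin d)) := closedBall 0 R
  have hB : MeasurableSet B := measurableSet_closedBall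
  set C : ℝ := volume.real B + 1
  have hC : 0 < C := by positivity
  have hInt : ∀ i, IntegrableOn (fun x => ‖u i x‖) B volume := fun i =>
    (integrableOn_norm_closedBall h.one_lt_left R (u i)).1
  have hIntC : ∀ i, ∫ x in B, ‖u i x‖ ≤ C := fun i =>
    (integrableOn_norm_closedBall h.one_lt_left R (u i)).2.trans
      (add_le_add le_rfl (Real.rpow_le_one (norm_nonneg _) (hu i) h.left_pos.le))
  set Φ : ι → EuclideanSpace ℝ (Fin d) → ℂ := fun i => convOp k (B.indicator (u i)) with hΦ
  have hΦx : ∀ i x, Φ i x = ∫ y in B, k (x - y) * u i y := fun i x => by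
    simp only [hΦ]
    rw [convOp_apply, ← integral_indicator hB]
    congr with y
    by_cases hy : y ∈ B <;> simp [hy]
  obtain ⟨D, hD⟩ := hcs.exists_bound_of_continuous hcont
  have hbound : ∀ (m : ℝ) (i : ι) (φ : EuclideanSpace ℝ (Fin d) → ℂ), (∀ y, ‖φ y‖ ≤ m) →
      0 ≤ m → ‖∫ y in B, φ y * u i y‖ ≤ m * C := by
    intro m i φ hφ hm
    calc ‖∫ y in B, φ y * u i y‖ ≤ ∫ y in B, m * ‖u i y‖ := by
          refine norm_integral_le_of_norm_le ((hInt i).const_mul m) (.of_forall fun y => ?_)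
          rw [norm_mul]
          gcongr
          exact hφ y
      _ ≤ m * C := by
          rw [integral_const_mul]
          gcongr
          exact hIntC i
  have hΦint : ∀ i x, IntegrableOn (fun y => k (x - y) * u i y) B volume := fun i x =>
    Integrable.mono' ((hInt i).const_mul D)
      ((aestronglyMeasurable_kernel hk.1 x).mul (Lp.memLp (u i)).1).restrict
      (.of_forall fun y => by
        rw [norm_mul]
        gcongr
        exact hD _)
  have hequi : UniformEquicontinuous Φ := by
    rw [Metric.uniformEquicontinuous_iff]
    intro ε hε
    obtain ⟨δ, hδ, hkδ⟩ := Metric.uniformContinuous_iff.1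
      (hcs.uniformContinuous_of_continuous hcont) (ε / (2 * C)) (by positivity)
    refine ⟨δ, hδ, fun x x' hxx' i => ?_⟩
    rw [dist_eq_norm, hΦx, hΦx, ← integral_sub (hΦint i x) (hΦint i x')]
    simp_rw [← sub_mul]
    refine (hbound (ε / (2 * C)) i (fun y => k (x - y) - k (x' - y)) (fun y => ?_)
      (by positivity)).trans_lt ?_
    · rw [← dist_eq_norm]
      exact (hkδ (by rwa [dist_sub_right])).le
    · have : ε / (2 * C) * C = ε / 2 := by field_simp
      rw [this]
      exact half_lt_self hε
  have hΦ0 : ∀ i x, x ∉ closedBall (0 : EuclideanSpace ℝ (Fin d)) (R + ρ) → Φ i x = 0 := by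
    intro i x hx
    refine convOp_indicator_eq_zero fun y hy => hkρ _ ?_
    rw [mem_closedBall_zero_iff] at hx hy
    have := norm_sub_norm_le x y
    linarith
  have hlim : ∀ x, ∃ z, Tendsto (fun i => Φ i x) U (𝓝 z) := by
    intro x
    have hD0 : 0 ≤ D := (norm_nonneg _).trans (hD 0)
    obtain ⟨z, -, hz⟩ := (isCompact_closedBall (0 : ℂ) (D * C)).ultrafilter_le_nhds
      (U.map fun i => Φ i x) (by
        rw [le_principal_iff]
        refine mem_map.2 (Eventually.of_forall (f := (U : Filter ι)) fun i => ?_)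
        change Φ i x ∈ closedBall 0 (D * C)
        rw [mem_closedBall_zero_iff, hΦx]
        exact hbound D i _ (fun y => hD _) hD0)
    exact ⟨z, hz⟩
  choose G hG using hlim
  have hGpi : Tendsto Φ U (𝓝 G) := tendsto_pi_nhds.2 hG
  have hGcont : Continuous G := hGpi.continuous_of_equicontinuous hequi.equicontinuous
  have hG0 : ∀ x, x ∉ closedBall (0 : EuclideanSpace ℝ (Fin d)) (R + ρ) → G x = 0 := by
    intro x hx
    refine tendsto_nhds_unique (hG x) ?_
    simp only [hΦ0 _ x hx]
    exact tendsto_const_nhds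
  have hGmem : MemLp G (ENNReal.ofReal s) volume :=
    hGcont.memLp_of_hasCompactSupport
      (HasCompactSupport.intro (isCompact_closedBall 0 (R + ρ)) hG0)
  have hunif : TendstoUniformlyOn Φ G U (closedBall 0 (R + ρ)) := by
    have := (EquicontinuousOn.tendsto_uniformOnFun_iff_pi (𝔖 := {K | IsCompact K})
      (fun K hK => hK) (Set.sUnion_eq_univ_iff.2 fun x => ⟨{x}, isCompact_singleton, rfl⟩)
      (fun K _ => hequi.equicontinuous.equicontinuousOn K) (U : Filter ι) G).2 hGpi
    exact UniformOnFun.tendsto_iff_tendstoUniformlyOn.1 this _ (isCompact_closedBall 0 (R + ρ))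
  refine ⟨hGmem.toLp G, ?_⟩
  have hΦmem : ∀ i, MemLp (Φ i) (ENNReal.ofReal s) volume := fun i =>
    h.memLp_convOp hk ((Lp.memLp (u i)).indicator hB)
  have hTΦ : ∀ i, convLp h hk (Lp.trunc hB (u i)) = (hΦmem i).toLp (Φ i) := fun i =>
    Lp.ext ((coeFn_convLp_trunc h hk hB (u i)).trans (hΦmem i).coeFn_toLp.symm)
  simp_rw [hTΦ]
  rw [Lp.tendsto_Lp_iff_tendsto_eLpNorm'']
  set V := volume (closedBall (0 : EuclideanSpace ℝ (Fin d)) (R + ρ))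
  have hV : V ^ (1 / s) ≠ ⊤ :=
    ENNReal.rpow_ne_top_of_nonneg (by have := h.pos; positivity) measure_closedBall_lt_top.ne
  rw [ENNReal.tendsto_nhds_zero]
  intro ε hε
  obtain ⟨η, hη, hηε⟩ : ∃ η : ℝ, 0 < η ∧ ENNReal.ofReal η * V ^ (1 / s) ≤ ε := by
    have hlim : Tendsto (fun η : ℝ => ENNReal.ofReal η * V ^ (1 / s)) (𝓝[>] 0) (𝓝 0) := by
      have := ENNReal.Tendsto.mul_const (ENNReal.continuous_ofReal.tendsto 0)
        (b := V ^ (1 / s)) (.inr hV)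
      rw [ENNReal.ofReal_zero, zero_mul] at this
      exact this.mono_left nhdsWithin_le_nhds
    obtain ⟨η, h1, h2⟩ := ((hlim.eventually_le_const hε).and self_mem_nhdsWithin).exists
    exact ⟨η, h2, h1⟩
  filter_upwards [Metric.tendstoUniformlyOn_iff.1 hunif η hη] with i hi
  refine (eLpNorm_sub_le_of_dist_bdd volume ENNReal.ofReal_ne_top measurableSet_closedBall hη.le
    (fun x => ?_) (Function.support_subset_iff'.2 (hΦ0 i))
    (Function.support_subset_iff'.2 hG0)).trans ?_
  · by_cases hx : x ∈ closedBall 0 (R + ρ)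
    · rw [dist_comm]
      exact (hi x hx).le
    · rw [hΦ0 i x hx, hG0 x hx, dist_self]
      exact hη.le
  · rw [ENNReal.toReal_ofReal h.pos.le]
    exact hηε

end Compactness

/-! ### Existence of a maximizer -/

section Maximizer

variable {d : ℕ} {p q s : ℝ} {k : EuclideanSpace ℝ (Fin d) → ℂ}
  [Fact (1 ≤ ENNReal.ofReal p)] [Fact (1 ≤ ENNReal.ofReal s)]

/-- There is a maximizing sequence that keeps a fixed amount of mass near the origin. -/
theorem exists_maximizing_seq (h : YoungExponents p q s)
    (hk : MemLp k (ENNReal.ofReal q) volume) (hM : 0 < ‖convLp h hk‖) :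
    ∃ r c : ℝ, 0 < c ∧
      ∃ u : ℕ → Lp ℂ (ENNReal.ofReal p) (volume : Measure (EuclideanSpace ℝ (Fin d))),
        (∀ n, ‖u n‖ ≤ 1) ∧ Tendsto (fun n => ‖convLp h hk (u n)‖) atTop (𝓝 ‖convLp h hk‖) ∧
          ∀ n, c ≤ ‖Lp.trunc (measurableSet_closedBall (x := 0) (ε := r)) (u n)‖ := by
  set M := ‖convLp h hk‖
  obtain ⟨r, c, hc, hrc⟩ := exists_le_norm_trunc_closedBall h hk hM
  have key : ∀ n : ℕ, ∃ u : Lp ℂ (ENNReal.ofReal p)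
      (volume : Measure (EuclideanSpace ℝ (Fin d))),
      ‖u‖ ≤ 1 ∧ M - M / 2 * (1 / ((n : ℝ) + 1)) ≤ ‖convLp h hk u‖ ∧
        c ≤ ‖Lp.trunc (measurableSet_closedBall (x := 0) (ε := r)) u‖ := by
    intro n
    have hn : 0 < 1 / ((n : ℝ) + 1) := by positivity
    have hn1 : 1 / ((n : ℝ) + 1) ≤ 1 := by
      rw [div_le_one (by positivity)]
      exact le_add_of_nonneg_left n.cast_nonneg
    obtain ⟨u, hu, hTu⟩ := (convLp h hk).exists_lt_apply_of_lt_opNorm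
      (r := M - M / 2 * (1 / ((n : ℝ) + 1))) (sub_lt_self _ (by positivity))
    have hle : M / 2 * (1 / ((n : ℝ) + 1)) ≤ M / 2 := mul_le_of_le_one_right (by positivity) hn1
    obtain ⟨x₀, hx₀⟩ := hrc u hu.le (by linarith)
    obtain ⟨v, hv1, hv2, hv3⟩ := exists_translate h hk u x₀ r
    exact ⟨v, hv1.trans_le hu.le, hv2 ▸ hTu.le, hv3 ▸ hx₀⟩
  choose u hu1 hu2 hu3 using key
  refine ⟨r, c, hc, u, hu1, ?_, hu3⟩
  have hlim : Tendsto (fun n : ℕ => M - M / 2 * (1 / ((n : ℝ) + 1))) atTop (𝓝 M) := by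
    simpa using tendsto_const_nhds.sub
      ((tendsto_one_div_add_atTop_nhds_zero_nat (𝕜 := ℝ)).const_mul (M / 2))
  exact tendsto_of_tendsto_of_tendsto_of_le_of_le hlim tendsto_const_nhds hu2 fun n =>
    (convLp h hk).unit_le_opNorm _ (hu1 n)

/-- The operator attains its norm: along a nonprincipal ultrafilter, the images of a tight
maximizing sequence are within every `ε` of a convergent family, so they converge. -/
theorem exists_norm_convLp_eq (h : YoungExponents p q s)
    (hk : MemLp k (ENNReal.ofReal q) volume) (hM : 0 < ‖convLp h hk‖) :
    ∃ g, ‖g‖ = 1 ∧ ‖convLp h hk g‖ = ‖convLp h hk‖ := by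
  have : UniformConvexSpace
      (Lp ℂ (ENNReal.ofReal p) (volume : Measure (EuclideanSpace ℝ (Fin d)))) :=
    uniformConvexSpace_Lp h.one_lt_left
  obtain ⟨r, c, hc, u, hu1, hulim, huc⟩ := exists_maximizing_seq h hk hM
  set M := ‖convLp h hk‖
  set U : Ultrafilter ℕ := hyperfilter ℕ
  have hU : (U : Filter ℕ) ≤ atTop := Nat.hyperfilter_le_atTop
  have hcauchy : Cauchy (map (fun n => convLp h hk (u n)) (U : Filter ℕ)) := by
    rw [Metric.cauchy_iff]
    refine ⟨inferInstance, fun ε hε => ?_⟩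
    obtain ⟨δ, hδ, R, htight⟩ := exists_norm_trunc_compl_closedBall_le h hk hM r hc
      (ε := ε / (8 * M)) (by positivity)
    obtain ⟨k₀, hk₀, ρ, hcont, hcs, -, hkρ, hle⟩ :=
      exists_continuous_norm_convLp_sub_le h hk (η := ε / 8) (by positivity)
    obtain ⟨g, hg⟩ := exists_tendsto_convLp_trunc h hk₀ hcont hcs hkρ R U hu1
    have hev : ∀ᶠ n in (U : Filter ℕ), dist (convLp h hk (u n)) g < ε / 2 := by
      filter_upwards [hU (hulim.eventually_const_le (sub_lt_self M hδ)),
        Metric.tendsto_nhds.1 hg (ε / 4) (by positivity)] with n hn hn'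
      have h1 := htight (u n) (hu1 n) hn (huc n)
      set v := Lp.trunc (measurableSet_closedBall (x := 0) (ε := R)) (u n)
      set w := Lp.trunc (measurableSet_closedBall (x := 0) (ε := R)).compl (u n)
      have hvw : v + w = u n := Lp.trunc_add_trunc_compl _ _
      have e : convLp h hk (u n) - convLp h hk₀ v =
          (convLp h hk - convLp h hk₀) v + convLp h hk w := by
        rw [← hvw, map_add, sub_apply]
        abel
      have h2 : ‖(convLp h hk - convLp h hk₀) v‖ ≤ ε / 8 :=
        (ContinuousLinearMap.le_of_opNorm_le_of_le _ hle
          ((Lp.norm_trunc_le _ _).trans (hu1 n))).trans_eq (mul_one _)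
      have h3 : ‖convLp h hk w‖ ≤ ε / 8 := by
        refine (ContinuousLinearMap.le_of_opNorm_le_of_le _ le_rfl h1).trans_eq ?_
        change M * (ε / (8 * M)) = ε / 8
        field_simp
      have h4 : dist (convLp h hk (u n)) (convLp h hk₀ v) ≤ ε / 4 := by
        rw [dist_eq_norm, e]
        refine (norm_add_le _ _).trans ?_
        linarith
      have := dist_triangle (convLp h hk (u n)) (convLp h hk₀ v) g
      linarith
    refine ⟨_, image_mem_map hev, ?_⟩
    rintro _ ⟨m, hm, rfl⟩ _ ⟨n, hn, rfl⟩
    change dist _ g < _ at hm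
    change dist _ g < _ at hn
    have := dist_triangle_right (convLp h hk (u m)) (convLp h hk (u n)) g
    linarith
  obtain ⟨y, hy⟩ := CompleteSpace.complete hcauchy
  have hy' : Tendsto (fun n => convLp h hk (u n)) U (𝓝 y) := hy
  exact (convLp h hk).exists_norm_apply_eq_opNorm hM hu1 hy'
    (tendsto_nhds_unique hy'.norm (hulim.mono_left hU))

end Maximizer

theorem nontrivial_Lp {d : ℕ} {p : ℝ} (hp : 0 < p) :
    Nontrivial (Lp ℂ (ENNReal.ofReal p) (volume : Measure (EuclideanSpace ℝ (Fin d)))) := by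
  have hlt : volume (closedBall (0 : EuclideanSpace ℝ (Fin d)) 1) ≠ ⊤ :=
    measure_closedBall_lt_top.ne
  have hpos : 0 < volume (closedBall (0 : EuclideanSpace ℝ (Fin d)) 1) :=
    measure_closedBall_pos volume 0 one_pos
  refine ⟨indicatorConstLp _ measurableSet_closedBall hlt 1, 0, fun h0 => ?_⟩
  have := norm_indicatorConstLp (p := ENNReal.ofReal p) (hs := measurableSet_closedBall)
    (hμs := hlt) (c := (1 : ℂ)) (by simpa using hp) ENNReal.ofReal_ne_top
  rw [h0, Lp.norm_zero, norm_one, one_mul] at this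
  exact (Real.rpow_pos_of_pos (ENNReal.toReal_pos hpos.ne' hlt) _).ne this

theorem theorem1 (d : ℕ) (p q r : ℝ) (hp : 1 < p) (hq : 1 < q) (hr : 1 < r)
    (hpqr : 1 / p + 1 / q + 1 / r = 2)
    (k : EuclideanSpace ℝ (Fin d) → ℂ) (hk : MemLp k (ENNReal.ofReal q) volume) :
    IsBoundedConvOp k (ENNReal.ofReal p) (ENNReal.ofReal (Real.conjExponent r)) ∧
      ∃ f : EuclideanSpace ℝ (Fin d) → ℂ,
        IsConvMaximizer k (ENNReal.ofReal p) (ENNReal.ofReal (Real.conjExponent r)) f := by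
  have hconj := Real.HolderConjugate.conjExponent hr
  have h : YoungExponents p q (Real.conjExponent r) := by
    refine ⟨hp, hq, hconj.symm.pos, ?_⟩
    have := hconj.inv_add_inv_eq_one
    simp only [one_div] at hpqr
    linarith
  have : Fact (1 ≤ ENNReal.ofReal p) := ⟨ENNReal.one_le_ofReal.2 hp.le⟩
  have : Fact (1 ≤ ENNReal.ofReal (Real.conjExponent r)) :=
    ⟨ENNReal.one_le_ofReal.2 h.one_lt.le⟩
  have := nontrivial_Lp (d := d) h.left_pos
  refine ⟨⟨fun f hf => h.ae_integrable hk hf, fun f hf => h.memLp_convOp hk hf, ?_⟩, ?_⟩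
  · rw [convOpNorm_eq_enorm h hk]
    exact enorm_lt_top
  obtain ⟨g, hg1, hgT⟩ : ∃ g, ‖g‖ = 1 ∧ ‖convLp h hk g‖ = ‖convLp h hk‖ := by
    rcases (norm_nonneg (convLp h hk)).eq_or_lt with h0 | hM
    · -- the operator vanishes, and every unit vector is a maximizer
      obtain ⟨g, hg⟩ := exists_norm_eq
        (Lp ℂ (ENNReal.ofReal p) (volume : Measure (EuclideanSpace ℝ (Fin d)))) zero_le_one
      refine ⟨g, hg, le_antisymm ((convLp h hk).unit_le_opNorm _ hg.le) ?_⟩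
      rw [← h0]
      exact norm_nonneg _
    · exact exists_norm_convLp_eq h hk hM
  refine ⟨g, Lp.memLp g, ?_, ?_⟩
  · rw [← Lp.enorm_def, ← ofReal_norm, hg1, ENNReal.ofReal_one]
  · rw [convOpNorm_eq_enorm h hk, ← enorm_convLp h hk, ← ofReal_norm, ← ofReal_norm, hgT]
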